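/- Let $k$ be a field and let $\mathcal C$ be a tensor category over $k$: a $k$-linear abelian monoidal category whose tensor product is $k$-bilinear and exact in each variable and with $\dim_k\mathrm{End}(\mathbf 1)=1$. Let $\underline{\mathrm{Aut}_\otimes(\mathcal C)}$ be the monoidal category whose objects are the tensor autoequivalences of $\mathcal C$ ($k$-linear monoidal functors $\mathcal C\to\mathcal C$ that are equivalences), whose arrows are the monoidal natural isomorphisms, and whose tensor product is composition, $F\otimes F'=F\circ F'$. It is a categorical group (all arrows and all objects are invertible). Let $\mathrm{Aut}_\otimes(\mathcal C)$ be its group of isomorphism classes of objects, with $[F][F']=[F\circ F']$, and let $\mathrm{Aut}_\otimes(\mathrm{id}_{\mathcal C})$ be the abelian group of monoidal natural automorphisms of $\mathrm{id}_{\mathcal C}$, an $\mathrm{Aut}_\otimes(\mathcal C)$-module by $([F]\cdot a)_{F(V)}=F(a_V)$. Choose representatives $F_s\in s$ for $s\in\mathrm{Aut}_\otimes(\mathcal C)$ and isomorphisms $\varphi_{s,t}:F_s\otimes F_t\to F_{st}$; the elements $a(s,t,r)\in\mathrm{Aut}_\otimes(\mathrm{id}_{\mathcal C})$ that measure the difference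 between the two induced isomorphisms $(F_s\otimes F_t)\otimes F_r\to F_{str}$ form a 3-cocycle; let $[a]\in H^3(\mathrm{Aut}_\otimes(\mathcal C),\mathrm{Aut}_\otimes(\mathrm{id}_{\mathcal C}))$ be its class. Let $G$ be a group and let $f:G\to\mathrm{Aut}_\otimes(\mathcal C)$ be a group homomorphism, through which $\mathrm{Aut}_\otimes(\mathrm{id}_{\mathcal C})$ is a $G$-module. A $G$-action on $\mathcal C$ is a monoidal functor $R:\underline G\to\underline{\mathrm{Aut}_\otimes(\mathcal C)}$, where $\underline G$ is the discrete monoidal category of $G$; it realizes $f$ if $[R(g)]=f(g)$ for all $g\in G$; two realizations are equivalent if they are isomorphic as monoidal functors. 1. For every choice of the $F_s$ and $\varphi_{s,t}$: $f$ is realized by some $G$-action on $\mathcal C$ if and only if the pullback $f_*[a]\in H^3(G,\mathrm{Aut}_\otimes(\mathrm{id}_{\mathcal C}))$ is zero. 2. Suppose that $f$ is realizable, and fix any tensor autoequivalences $X_g\in f(g)$, $g\in G$. Then there is a bijection $z\mapsto R_z$ from the group $Z^2(G,\mathrm{Aut}_\otimes(\mathrm{id}_{\mathcal C}))$ of 2-cocycles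 to the set of realizations of $f$ with underlying objects $R(g)=X_g$ (that is, of monoidal structures on the functor $g\mapsto X_g$), under which the structure isomorphisms $X_g\otimes X_h\to X_{gh}$ of $R_z$ are those of $R_0$ followed by the action of $z(g,h)$ on $X_{gh}$ (the automorphism with components $z(g,h)_{X_{gh}(V)}$); and $[z]\mapsto[R_z]$ is a well-defined bijection from $H^2(G,\mathrm{Aut}_\otimes(\mathrm{id}_{\mathcal C}))$ to the set of equivalence classes of all realizations of $f$. -/

import Mathlib

open CategoryTheory MonoidalCategory

universe w v u

noncomputable section

/-! ### Categorical groups and their invariants -/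

/-- A categorical group: a monoidal category in which every arrow is invertible and every object
is invertible with respect to the tensor product. -/
class CategoricalGroup (𝒢 : Type u) [Category.{v} 𝒢] [MonoidalCategory 𝒢] : Prop where
  isIso_hom : ∀ {X Y : 𝒢} (f : X ⟶ Y), IsIso f
  exists_inverse : ∀ X : 𝒢, ∃ Y : 𝒢, Nonempty (X ⊗ Y ≅ 𝟙_ 𝒢) ∧ Nonempty (Y ⊗ X ≅ 𝟙_ 𝒢)

namespace CategoricalGroup

section IsoClasses

variable {𝒢 : Type u} [Category.{v} 𝒢]

variable (𝒢) in
/-- `π₀` of a categorical group: the set of isomorphism classes of objects. -/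
def Pi0 : Type u := Quotient (isIsomorphicSetoid 𝒢)

/-- The isomorphism class of an object. -/
def Pi0.mk (X : 𝒢) : Pi0 𝒢 := Quotient.mk (isIsomorphicSetoid 𝒢) X

theorem Pi0.mk_eq_iff {X Y : 𝒢} : Pi0.mk X = Pi0.mk Y ↔ Nonempty (X ≅ Y) := Quotient.eq

theorem Pi0.mk_surjective (s : Pi0 𝒢) : ∃ X : 𝒢, Pi0.mk X = s := Quotient.exists_rep s

end IsoClasses

section Basic

variable {𝒢 : Type u} [Category.{v} 𝒢] [MonoidalCategory 𝒢]

/-- An automorphism `a` of the unit object acts on every object `Y` through `𝟙 ⊗ Y ≅ Y`. -/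
def leftAct (a : Aut (𝟙_ 𝒢)) (Y : 𝒢) : Y ⟶ Y := (λ_ Y).inv ≫ a.hom ▷ Y ≫ (λ_ Y).hom

/-- An automorphism `a` of the unit object acts on every object `Y` through `Y ⊗ 𝟙 ≅ Y`. -/
def rightAct (a : Aut (𝟙_ 𝒢)) (Y : 𝒢) : Y ⟶ Y := (ρ_ Y).inv ≫ Y ◁ a.hom ≫ (ρ_ Y).hom

theorem leftAct_naturality (a : Aut (𝟙_ 𝒢)) {Y Z : 𝒢} (h : Y ⟶ Z) :
    leftAct a Y ≫ h = h ≫ leftAct a Z := by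
  simp only [leftAct, Category.assoc, leftUnitor_inv_naturality_assoc, whisker_exchange_assoc,
    leftUnitor_naturality]

theorem leftAct_naturality_assoc (a : Aut (𝟙_ 𝒢)) {Y Z W : 𝒢} (h : Y ⟶ Z) (h' : Z ⟶ W) :
    leftAct a Y ≫ h ≫ h' = h ≫ leftAct a Z ≫ h' := by
  rw [← Category.assoc, leftAct_naturality, Category.assoc]

theorem leftAct_whiskerRight (a : Aut (𝟙_ 𝒢)) (Y Z : 𝒢) :
    leftAct a Y ▷ Z = leftAct a (Y ⊗ Z) := by
  simp [leftAct]

theorem rightAct_whiskerRight (a : Aut (𝟙_ 𝒢)) (Y Z : 𝒢) :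
    rightAct a Y ▷ Z = Y ◁ leftAct a Z := by
  simp [leftAct, rightAct]

theorem leftAct_unit (a : Aut (𝟙_ 𝒢)) : leftAct a (𝟙_ 𝒢) = a.hom := by
  simp [leftAct, unitors_equal, unitors_inv_equal]

theorem rightAct_unit (a : Aut (𝟙_ 𝒢)) : rightAct a (𝟙_ 𝒢) = a.hom := by
  simp [rightAct, ← unitors_equal, ← unitors_inv_equal]

theorem leftAct_mul (a b : Aut (𝟙_ 𝒢)) (Y : 𝒢) :
    leftAct (a * b) Y = leftAct b Y ≫ leftAct a Y := by
  simp [leftAct, show (a * b).hom = b.hom ≫ a.hom from rfl]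

theorem rightAct_mul (a b : Aut (𝟙_ 𝒢)) (Y : 𝒢) :
    rightAct (a * b) Y = rightAct b Y ≫ rightAct a Y := by
  simp [rightAct, show (a * b).hom = b.hom ≫ a.hom from rfl]

theorem leftAct_one (Y : 𝒢) : leftAct (1 : Aut (𝟙_ 𝒢)) Y = 𝟙 Y := by
  simp [leftAct, show (1 : Aut (𝟙_ 𝒢)).hom = 𝟙 _ from rfl]

/-- The automorphisms of the unit object form an abelian group. -/
instance : CommGroup (Aut (𝟙_ 𝒢)) where
  mul_comm a b := by
    ext
    have h := leftAct_naturality a (leftAct b (𝟙_ 𝒢))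
    rw [← leftAct_mul, ← leftAct_mul, leftAct_unit, leftAct_unit] at h
    exact h.symm

variable (𝒢) in
/-- `π₁` of a categorical group: the abelian group of automorphisms of the unit object. -/
abbrev Pi1 : Type v := Aut (𝟙_ 𝒢)

end Basic

section Invariants

variable {𝒢 : Type u} [Category.{v} 𝒢] [MonoidalCategory 𝒢] [CategoricalGroup 𝒢]

/-- `π₀` is a group, with `[X][Y] = [X ⊗ Y]`. -/
instance : Group (Pi0 𝒢) where
  mul := Quotient.map₂ (fun X Y => X ⊗ Y) fun _ _ ⟨e⟩ _ _ ⟨e'⟩ => ⟨e ⊗ᵢ e'⟩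
  one := Pi0.mk (𝟙_ 𝒢)
  inv := Quotient.map (fun X => (exists_inverse X).choose) fun X X' ⟨e⟩ => by
    obtain ⟨-, ⟨i⟩⟩ := (exists_inverse X).choose_spec
    obtain ⟨⟨j⟩, -⟩ := (exists_inverse X').choose_spec
    exact ⟨(ρ_ _).symm ≪≫ (Iso.refl _ ⊗ᵢ (j.symm ≪≫ (e.symm ⊗ᵢ Iso.refl _))) ≪≫ (α_ _ _ _).symm ≪≫
      (i ⊗ᵢ Iso.refl _) ≪≫ λ_ _⟩
  mul_assoc := by
    rintro ⟨X⟩ ⟨Y⟩ ⟨Z⟩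
    exact Quotient.sound ⟨α_ X Y Z⟩
  one_mul := by
    rintro ⟨X⟩
    exact Quotient.sound ⟨λ_ X⟩
  mul_one := by
    rintro ⟨X⟩
    exact Quotient.sound ⟨ρ_ X⟩
  inv_mul_cancel := by
    rintro ⟨X⟩
    exact Quotient.sound (exists_inverse X).choose_spec.2

theorem Pi0.mk_tensor (X Y : 𝒢) : Pi0.mk (X ⊗ Y) = Pi0.mk X * Pi0.mk Y := rfl

theorem Pi0.mk_unit : Pi0.mk (𝟙_ 𝒢) = 1 := rfl

theorem leftAct_bijective (X : 𝒢) :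
    Function.Bijective (fun a : Pi1 𝒢 => (leftAct a X : X ⟶ X)) := by
  obtain ⟨Y, ⟨i⟩, ⟨j⟩⟩ := exists_inverse X
  let E : 𝒢 ≌ 𝒢 := CategoryTheory.Equivalence.mk (tensorRight X) (tensorRight Y)
    ((rightUnitorNatIso 𝒢).symm ≪≫ (tensoringRight 𝒢).mapIso i.symm ≪≫ tensorRightTensor X Y)
    ((tensorRightTensor Y X).symm ≪≫ (tensoringRight 𝒢).mapIso j ≪≫ rightUnitorNatIso 𝒢)
  have hE : (tensorRight X).IsEquivalence := E.isEquivalence_functor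
  constructor
  · intro a b h
    ext
    apply (tensorRight X).map_injective
    simpa [leftAct] using h
  · intro h
    obtain ⟨a, ha⟩ := (tensorRight X).map_surjective ((λ_ X).hom ≫ h ≫ (λ_ X).inv)
    have := isIso_hom a
    refine ⟨asIso a, ?_⟩
    have ha' : a ▷ X = (λ_ X).hom ≫ h ≫ (λ_ X).inv := ha
    simp [leftAct, ha']

theorem exists_conj (s : Pi0 𝒢) (a : Pi1 𝒢) :
    ∃ b : Pi1 𝒢, ∀ X : 𝒢, Pi0.mk X = s → leftAct b X = rightAct a X := by
  obtain ⟨X, rfl⟩ := Pi0.mk_surjective s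
  obtain ⟨b, hb⟩ := (leftAct_bijective X).2 (rightAct a X)
  refine ⟨b, fun Y hY => ?_⟩
  obtain ⟨e⟩ := Pi0.mk_eq_iff.1 hY
  rw [← cancel_mono e.hom, leftAct_naturality]
  have : rightAct a Y ≫ e.hom = e.hom ≫ rightAct a X := by
    simp only [rightAct, Category.assoc, rightUnitor_inv_naturality_assoc, whisker_exchange_assoc,
      ← rightUnitor_naturality]
  rw [this]
  exact congrArg (e.hom ≫ ·) hb

/-- The natural action of `π₀` on `π₁` by conjugation: `[X] • a` is the automorphism `b` of the
unit object such that `b ⊗ X` and `X ⊗ a` are the same automorphism of `X`. -/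
instance : SMul (Pi0 𝒢) (Pi1 𝒢) where
  smul s a := (exists_conj s a).choose

theorem leftAct_smul (X : 𝒢) (a : Pi1 𝒢) : leftAct (Pi0.mk X • a) X = rightAct a X :=
  (exists_conj (Pi0.mk X) a).choose_spec X rfl

theorem smul_eq_iff (X : 𝒢) (a b : Pi1 𝒢) : Pi0.mk X • a = b ↔ leftAct b X = rightAct a X := by
  rw [← leftAct_smul]
  exact ⟨fun h => by rw [h], fun h => ((leftAct_bijective X).1 h).symm⟩

theorem whiskerLeft_leftAct (X Y : 𝒢) (a : Pi1 𝒢) :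
    X ◁ leftAct a Y = leftAct (Pi0.mk X • a) (X ⊗ Y) := by
  rw [← rightAct_whiskerRight, ← leftAct_smul, leftAct_whiskerRight]

instance : MulDistribMulAction (Pi0 𝒢) (Pi1 𝒢) where
  one_smul a := by
    rw [← Pi0.mk_unit, smul_eq_iff, leftAct_unit, rightAct_unit]
  mul_smul s t a := by
    obtain ⟨X, rfl⟩ := Pi0.mk_surjective s
    obtain ⟨Y, rfl⟩ := Pi0.mk_surjective t
    rw [← Pi0.mk_tensor, smul_eq_iff, ← whiskerLeft_leftAct, leftAct_smul]
    simp [rightAct]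
  smul_mul s a b := by
    obtain ⟨X, rfl⟩ := Pi0.mk_surjective s
    rw [smul_eq_iff, leftAct_mul, rightAct_mul, leftAct_smul, leftAct_smul]
  smul_one s := by
    obtain ⟨X, rfl⟩ := Pi0.mk_surjective s
    rw [smul_eq_iff, leftAct_one]
    simp [rightAct, show (1 : Aut (𝟙_ 𝒢)).hom = 𝟙 _ from rfl]

variable (𝒢) in
/-- The auxiliary choices needed to write down the associator as a 3-cochain: an object `rep s` in
every isomorphism class `s`, and isomorphisms `rep s ⊗ rep t ≅ rep (s * t)`. -/
structure Choices where
  rep : Pi0 𝒢 → 𝒢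
  mk_rep : ∀ s, Pi0.mk (rep s) = s
  φ : ∀ s t, rep s ⊗ rep t ≅ rep (s * t)

instance : Nonempty (Choices 𝒢) := by
  choose rep mk_rep using Pi0.mk_surjective (𝒢 := 𝒢)
  have h : ∀ s t, Nonempty (rep s ⊗ rep t ≅ rep (s * t)) := fun s t => by
    rw [← Pi0.mk_eq_iff, Pi0.mk_tensor, mk_rep, mk_rep, mk_rep]
  exact ⟨⟨rep, mk_rep, fun s t => (h s t).some⟩⟩

namespace Choices

variable (D : Choices 𝒢)

/-- The chosen isomorphisms, with the equality `s * t = u` as an argument. -/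
def φ' {s t u : Pi0 𝒢} (h : s * t = u) : D.rep s ⊗ D.rep t ≅ D.rep u :=
  D.φ s t ≪≫ eqToIso (congrArg D.rep h)

theorem exists_assoc (s t r : Pi0 𝒢) : ∃ a : Pi1 𝒢,
    ((D.φ s t).hom ▷ D.rep r ≫ (D.φ (s * t) r).hom ≫ eqToHom (congrArg D.rep (mul_assoc s t r))) ≫
        leftAct a (D.rep (s * (t * r))) =
      (α_ (D.rep s) (D.rep t) (D.rep r)).hom ≫ D.rep s ◁ (D.φ t r).hom ≫ (D.φ s (t * r)).hom := by
  have := isIso_hom ((D.φ s t).hom ▷ D.rep r ≫ (D.φ (s * t) r).hom ≫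
    eqToHom (congrArg D.rep (mul_assoc s t r)))
  obtain ⟨a, ha⟩ := (leftAct_bijective (D.rep (s * (t * r)))).2
    (inv ((D.φ s t).hom ▷ D.rep r ≫ (D.φ (s * t) r).hom ≫
      eqToHom (congrArg D.rep (mul_assoc s t r))) ≫
    (α_ (D.rep s) (D.rep t) (D.rep r)).hom ≫ D.rep s ◁ (D.φ t r).hom ≫ (D.φ s (t * r)).hom)
  exact ⟨a, by rw [show leftAct a _ = _ from ha, IsIso.hom_inv_id_assoc]⟩

/-- The associator cochain `a(s, t, r) ∈ π₁`: it compares the two isomorphisms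
`(rep s ⊗ rep t) ⊗ rep r ⟶ rep (s * t * r)`, the second of which goes through the associator. -/
def assoc (s t r : Pi0 𝒢) : Pi1 𝒢 := (D.exists_assoc s t r).choose

theorem assoc_spec {s t r u v w : Pi0 𝒢} (h₁ : s * t = u) (h₂ : u * r = w) (h₃ : t * r = v)
    (h₄ : s * v = w) :
    (D.φ' h₁).hom ▷ D.rep r ≫ (D.φ' h₂).hom ≫ leftAct (D.assoc s t r) (D.rep w) =
      (α_ (D.rep s) (D.rep t) (D.rep r)).hom ≫ D.rep s ◁ (D.φ' h₃).hom ≫ (D.φ' h₄).hom := by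
  subst h₁ h₃ h₄
  have h := (D.exists_assoc s t r).choose_spec
  simpa [φ', assoc] using h

/-- The pentagon axiom: the associator cochain is a 3-cocycle. -/
theorem assoc_cocycle (a b c d : Pi0 𝒢) :
    D.assoc a b c * D.assoc a (b * c) d * (a • D.assoc b c d) =
      D.assoc (a * b) c d * D.assoc a b (c * d) := by
  have e₁ : a * b * c * d = a * (b * (c * d)) := by simp only [mul_assoc]
  have e₂ : a * b * c = a * (b * c) := by simp only [mul_assoc]
  have e₃ : a * (b * c) * d = a * (b * (c * d)) := by simp only [mul_assoc]
  have e₄ : a * b * (c * d) = a * (b * (c * d)) := by simp only [mul_assoc]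
  have e₅ : b * c * d = b * (c * d) := by simp only [mul_assoc]
  rw [mul_comm (D.assoc a b c * D.assoc a (b * c) d), mul_comm (D.assoc a b c), ← mul_assoc,
    mul_comm (D.assoc (a * b) c d)]
  apply (leftAct_bijective (D.rep (a * (b * (c * d))))).1
  dsimp only
  have := isIso_hom (((D.φ' (rfl : a * b = _)).hom ▷ D.rep c ≫ (D.φ' e₂).hom) ▷ D.rep d ≫
    (D.φ' e₃).hom)
  rw [← cancel_epi (((D.φ' (rfl : a * b = _)).hom ▷ D.rep c ≫ (D.φ' e₂).hom) ▷ D.rep d ≫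
    (D.φ' e₃).hom)]
  have A₁ := D.assoc_spec (rfl : a * b = _) e₂ (rfl : b * c = _) (rfl : a * (b * c) = _)
  have A₂ := D.assoc_spec (rfl : a * (b * c) = _) e₃ e₅ (rfl : a * (b * (c * d)) = _)
  have A₃ := D.assoc_spec (rfl : b * c = _) e₅ (rfl : c * d = _) (rfl : b * (c * d) = _)
  have A₄ := D.assoc_spec e₂ e₃ (rfl : c * d = _) e₄
  have A₅ := D.assoc_spec (rfl : a * b = _) e₄ (rfl : b * (c * d) = _)
    (rfl : a * (b * (c * d)) = _)
  simp only [leftAct_mul, comp_whiskerRight, Category.assoc]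
  have ha : ∀ x, D.rep a ◁ leftAct x (D.rep (b * (c * d))) ≫ (D.φ' rfl).hom =
      (D.φ' rfl).hom ≫ leftAct (a • x) (D.rep (a * (b * (c * d)))) := fun x => by
    rw [whiskerLeft_leftAct, leftAct_naturality, D.mk_rep]
  calc
    _ = ((D.φ' (rfl : a * b = _)).hom ▷ D.rep c ≫ (D.φ' e₂).hom ≫
          leftAct (D.assoc a b c) _) ▷ D.rep d ≫ (D.φ' e₃).hom ≫
          leftAct (D.assoc a (b * c) d) _ ≫ leftAct (a • D.assoc b c d) _ := by
      simp only [comp_whiskerRight, Category.assoc, leftAct_whiskerRight,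
        leftAct_naturality_assoc _ (D.φ' e₃).hom]
    _ = (α_ _ _ _).hom ▷ D.rep d ≫ (D.rep a ◁ (D.φ' (rfl : b * c = _)).hom) ▷ D.rep d ≫
          (α_ _ _ _).hom ≫ D.rep a ◁ (D.φ' e₅).hom ≫ (D.φ' rfl).hom ≫
          leftAct (a • D.assoc b c d) _ := by
      rw [A₁]
      simp only [comp_whiskerRight, Category.assoc]
      rw [reassoc_of% A₂]
    _ = (α_ _ _ _).hom ▷ D.rep d ≫ (α_ _ _ _).hom ≫
          D.rep a ◁ ((D.φ' (rfl : b * c = _)).hom ▷ D.rep d ≫ (D.φ' e₅).hom ≫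
            leftAct (D.assoc b c d) _) ≫ (D.φ' rfl).hom := by
      simp only [whiskerLeft_comp, Category.assoc, ha, associator_naturality_middle_assoc]
    _ = (α_ _ _ _).hom ≫ (α_ _ _ _).hom ≫ D.rep a ◁ D.rep b ◁ (D.φ' (rfl : c * d = _)).hom ≫
          D.rep a ◁ (D.φ' (rfl : b * (c * d) = _)).hom ≫ (D.φ' rfl).hom := by
      rw [A₃]
      simp only [whiskerLeft_comp, Category.assoc, pentagon_assoc]
    _ = (D.φ' (rfl : a * b = _)).hom ▷ D.rep c ▷ D.rep d ≫ (α_ _ _ _).hom ≫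
          D.rep (a * b) ◁ (D.φ' (rfl : c * d = _)).hom ≫ (D.φ' e₄).hom ≫
          leftAct (D.assoc a b (c * d)) _ := by
      rw [associator_naturality_left_assoc, ← whisker_exchange_assoc, A₅,
        associator_naturality_right_assoc]
    _ = _ := by
      rw [← reassoc_of% A₄]

end Choices

end Invariants

section Cohomology

/-! The cohomology groups are those of Mathlib (inhomogeneous cochains), which asks the group, the
module and the base ring to lie in one universe; hence `ULift ℤ` in place of `ℤ`. -/

variable (𝒢 : Type u) [Category.{u} 𝒢] [MonoidalCategory 𝒢] [CategoricalGroup 𝒢]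

/-- `π₁`, written additively, as a `π₀`-module. -/
abbrev pi1Rep : Rep.{u} (ULift.{u} ℤ) (Pi0 𝒢) :=
  Rep.of (X := Additive (Pi1 𝒢))
    { toFun := fun s =>
        { toFun := fun a => Additive.ofMul (s • a.toMul)
          map_add' := fun a b => smul_mul' s a.toMul b.toMul
          map_smul' := fun n a =>
            map_zpow (MulDistribMulAction.toMonoidHom (Pi1 𝒢) s) a.toMul n.down }
      map_one' := by
        refine LinearMap.ext fun a => ?_
        exact one_smul (Pi0 𝒢) a.toMul
      map_mul' := fun s t => by
        refine LinearMap.ext fun a => ?_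
        exact mul_smul s t a.toMul }

variable {𝒢}

/-- The associator as a 3-cochain of `π₀` with values in `π₁`. -/
def Choices.assocCochain (D : Choices 𝒢) (g : Fin 3 → Pi0 𝒢) : pi1Rep 𝒢 :=
  (Additive.ofMul (D.assoc (g 0) (g 1) (g 2)) : Additive (Pi1 𝒢))

theorem Choices.d_assocCochain (D : Choices 𝒢) :
    inhomogeneousCochains.d (pi1Rep 𝒢) 3 D.assocCochain = 0 := by
  refine funext fun g => ?_
  have h : (Additive.ofMul (D.assoc (g 0) (g 1) (g 2)) : Additive (Pi1 𝒢)) +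
      Additive.ofMul (D.assoc (g 0) (g 1 * g 2) (g 3)) +
      Additive.ofMul (g 0 • D.assoc (g 1) (g 2) (g 3)) =
      Additive.ofMul (D.assoc (g 0 * g 1) (g 2) (g 3)) +
      Additive.ofMul (D.assoc (g 0) (g 1) (g 2 * g 3)) :=
    congrArg Additive.ofMul (D.assoc_cocycle (g 0) (g 1) (g 2) (g 3))
  have h' : (pi1Rep 𝒢).ρ (g 0) (D.assocCochain fun i => g i.succ) =
      (Additive.ofMul (g 0 • D.assoc (g 1) (g 2) (g 3)) : Additive (Pi1 𝒢)) := rfl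
  rw [inhomogeneousCochains.d_hom_apply, h']
  simp only [Fin.sum_univ_succ]
  simp only [Fin.val_zero, Fin.succ_zero_eq_one, Fin.val_one, Finset.univ_eq_empty,
    Finset.sum_empty]
  have h₀ : D.assocCochain (Fin.contractNth 0 (· * ·) g) =
      (Additive.ofMul (D.assoc (g 0 * g 1) (g 2) (g 3)) : Additive (Pi1 𝒢)) := rfl
  have h₁ : D.assocCochain (Fin.contractNth 1 (· * ·) g) =
      (Additive.ofMul (D.assoc (g 0) (g 1 * g 2) (g 3)) : Additive (Pi1 𝒢)) := rfl
  have h₂ : D.assocCochain (Fin.contractNth 2 (· * ·) g) =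
      (Additive.ofMul (D.assoc (g 0) (g 1) (g 2 * g 3)) : Additive (Pi1 𝒢)) := rfl
  have h₃ : D.assocCochain (Fin.contractNth 3 (· * ·) g) =
      (Additive.ofMul (D.assoc (g 0) (g 1) (g 2)) : Additive (Pi1 𝒢)) := rfl
  simp
  rw [h₀, h₁, h₂, h₃]
  change _ = (0 : Additive (Pi1 𝒢))
  rw [← sub_eq_zero] at h
  rw [← h]
  abel

/-- The associator class in `H³(π₀, π₁)`. -/
def Choices.assocClass (D : Choices 𝒢) : groupCohomology (pi1Rep 𝒢) 3 :=
  groupCohomology.π (pi1Rep 𝒢) 3 (groupCohomology.cocyclesMk D.assocCochain D.d_assocCochain)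

variable {G : Type u} [Group G]

/-- `π₁` as a `G`-module through a group homomorphism `f : G → π₀`. -/
abbrev pi1Res (f : G →* Pi0 𝒢) : Rep.{u} (ULift.{u} ℤ) G := Rep.res f (pi1Rep 𝒢)

/-- The pullback `H³(π₀, π₁) → H³(G, π₁)` along a group homomorphism `f : G → π₀`. -/
def pullbackH3 (f : G →* Pi0 𝒢) (c : groupCohomology (pi1Rep 𝒢) 3) :
    groupCohomology (pi1Res f) 3 :=
  groupCohomology.map f (𝟙 (pi1Res f)) 3 c

end Cohomology

section Functors

variable (G : Type w) [Group G] (𝒢 : Type u) [Category.{v} 𝒢] [MonoidalCategory 𝒢]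

/-- A monoidal functor from the discrete categorical group of a group `G` to `𝒢`. -/
structure DiscreteMonoidalFunctor where
  functor : Discrete G ⥤ 𝒢
  monoidal : functor.Monoidal

attribute [instance] DiscreteMonoidalFunctor.monoidal

variable {G 𝒢}

/-- The group homomorphism `G → π₀` induced by a monoidal functor. -/
def DiscreteMonoidalFunctor.pi0 [CategoricalGroup 𝒢] (R : DiscreteMonoidalFunctor G 𝒢) :
    G →* Pi0 𝒢 where
  toFun g := Pi0.mk (R.functor.obj ⟨g⟩)
  map_one' := (Pi0.mk_eq_iff.2 ⟨Functor.Monoidal.εIso R.functor⟩).symm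
  map_mul' g h := (Pi0.mk_eq_iff.2 ⟨Functor.Monoidal.μIso R.functor ⟨g⟩ ⟨h⟩⟩).symm

/-- The realizations of a group homomorphism `f : G → π₀` as a monoidal functor. -/
def Realization [CategoricalGroup 𝒢] (f : G →* Pi0 𝒢) : Type _ :=
  { R : DiscreteMonoidalFunctor G 𝒢 // R.pi0 = f }

/-- Two realizations are equivalent if they are isomorphic as monoidal functors. -/
instance realizationSetoid [CategoricalGroup 𝒢] (f : G →* Pi0 𝒢) : Setoid (Realization f) where
  r R S := ∃ e : R.1.functor ≅ S.1.functor, NatTrans.IsMonoidal e.hom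
  iseqv :=
    { refl := fun _ => ⟨Iso.refl _, NatTrans.IsMonoidal.id⟩
      symm := fun ⟨e, _⟩ => ⟨e.symm, inferInstanceAs (NatTrans.IsMonoidal e.inv)⟩
      trans := fun ⟨e, _⟩ ⟨e', _⟩ =>
        ⟨e ≪≫ e', inferInstanceAs (NatTrans.IsMonoidal (e.hom ≫ e'.hom))⟩ }

/-- The realizations of `f` whose underlying objects are a given system `X` of representatives of
the classes `f g`: these are the monoidal structures on the functor `g ↦ X g`. -/
abbrev RealizationOn (X : G → 𝒢) : Type _ := (Discrete.functor X).Monoidal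

/-- The realization given by a monoidal structure on the functor `g ↦ X g`. -/
def RealizationOn.toRealization [CategoricalGroup 𝒢] {f : G →* Pi0 𝒢} {X : G → 𝒢}
    (hX : ∀ g, Pi0.mk (X g) = f g) (m : RealizationOn X) : Realization f :=
  ⟨⟨Discrete.functor X, m⟩, MonoidHom.ext hX⟩

/-- The structure isomorphism `X g ⊗ X h ⟶ X (g * h)`. -/
def RealizationOn.μ {X : G → 𝒢} (m : RealizationOn X) (g h : G) : X g ⊗ X h ⟶ X (g * h) :=
  m.toLaxMonoidal.μ ⟨g⟩ ⟨h⟩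

end Functors

end CategoricalGroup

/-! ### Tensor categories and their tensor autoequivalences -/

set_option linter.unusedSectionVars false
set_option linter.style.haveILetI false

section Tensor

variable (k : Type w) [Field k] (C : Type u) [Category.{v} C] [Abelian C] [Linear k C]
  [MonoidalCategory C] [MonoidalPreadditive C]

/-- A tensor category over a field `k`: a `k`-linear abelian category with a monoidal structure
whose tensor product is `k`-bilinear and exact in each variable, and whose unit object has a
one-dimensional endomorphism algebra. -/
class TensorCategory : Prop extends MonoidalLinear k C where
  exact_tensorLeft : ∀ X : C, Limits.PreservesFiniteLimits (tensorLeft X) ∧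
    Limits.PreservesFiniteColimits (tensorLeft X)
  exact_tensorRight : ∀ X : C, Limits.PreservesFiniteLimits (tensorRight X) ∧
    Limits.PreservesFiniteColimits (tensorRight X)
  finrank_end_unit : Module.finrank k (𝟙_ C ⟶ 𝟙_ C) = 1

/-- A tensor autoequivalence of `C`: a `k`-linear monoidal functor `C ⥤ C` that is an equivalence of
categories. -/
structure TensorAut where
  functor : C ⥤ C
  [monoidal : functor.Monoidal]
  [additive : functor.Additive]
  [linear : functor.Linear k]
  [isEquivalence : functor.IsEquivalence]

namespace TensorAut

attribute [instance] monoidal additive linear isEquivalence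

variable {k C}

/-- The arrows between tensor autoequivalences: monoidal natural isomorphisms. -/
@[ext]
structure Hom (F F' : TensorAut k C) where
  iso : F.functor ≅ F'.functor
  [isMonoidal : NatTrans.IsMonoidal iso.hom]

attribute [instance] Hom.isMonoidal

instance : Category (TensorAut k C) where
  Hom := Hom
  id _ := { iso := Iso.refl _, isMonoidal := NatTrans.IsMonoidal.id }
  comp α β :=
    { iso := α.iso ≪≫ β.iso
      isMonoidal := inferInstanceAs (NatTrans.IsMonoidal (α.iso.hom ≫ β.iso.hom)) }
  id_comp α := Hom.ext (Iso.refl_trans α.iso)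
  comp_id α := Hom.ext (Iso.trans_refl α.iso)
  assoc α β γ := Hom.ext (Iso.trans_assoc α.iso β.iso γ.iso)

@[simp] theorem id_app (F : TensorAut k C) (V : C) :
    (Hom.iso (𝟙 F)).hom.app V = 𝟙 (F.functor.obj V) := rfl

@[simp] theorem comp_app {F F' F'' : TensorAut k C} (α : F ⟶ F') (β : F' ⟶ F'') (V : C) :
    (Hom.iso (α ≫ β)).hom.app V = (Hom.iso α).hom.app V ≫ (Hom.iso β).hom.app V := rfl

theorem hom_ext {F F' : TensorAut k C} {α β : F ⟶ F'}
    (h : ∀ V, (Hom.iso α).hom.app V = (Hom.iso β).hom.app V) : α = β :=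
  Hom.ext (Iso.ext (NatTrans.ext (funext h)))

def mkIso {F F' : TensorAut k C} (e : F.functor ≅ F'.functor) [h : NatTrans.IsMonoidal e.hom] :
    F ≅ F' where
  hom := { iso := e, isMonoidal := h }
  inv := { iso := e.symm, isMonoidal := inferInstanceAs (NatTrans.IsMonoidal e.inv) }
  hom_inv_id := Hom.ext e.self_symm_id
  inv_hom_id := Hom.ext e.symm_self_id

/-- The composition `F ∘ F'`. -/
def comp (F F' : TensorAut k C) : TensorAut k C where
  functor := F'.functor ⋙ F.functor

variable (k C) in
/-- The identity functor of `C`. -/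
def one : TensorAut k C where
  functor := 𝟭 C

/-- The tensor product is the composition `F ⊗ F' = F ∘ F'`. -/
instance : MonoidalCategoryStruct (TensorAut k C) where
  tensorObj := comp
  tensorUnit := one k C
  whiskerLeft F _ _ α :=
    { iso := Functor.isoWhiskerRight (Hom.iso α) F.functor
      isMonoidal :=
        inferInstanceAs (NatTrans.IsMonoidal (Functor.whiskerRight (Hom.iso α).hom F.functor)) }
  whiskerRight α F :=
    { iso := Functor.isoWhiskerLeft F.functor (Hom.iso α)
      isMonoidal :=
        inferInstanceAs (NatTrans.IsMonoidal (Functor.whiskerLeft F.functor (Hom.iso α).hom)) }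
  associator F F' F'' := mkIso (F := comp (comp F F') F'') (F' := comp F (comp F' F''))
    (Functor.associator F''.functor F'.functor F.functor).symm
    (h := inferInstanceAs
      (NatTrans.IsMonoidal (Functor.associator F''.functor F'.functor F.functor).inv))
  leftUnitor F := mkIso (F := comp (one k C) F) F.functor.rightUnitor
    (h := inferInstanceAs (NatTrans.IsMonoidal F.functor.rightUnitor.hom))
  rightUnitor F := mkIso (F := comp F (one k C)) F.functor.leftUnitor
    (h := inferInstanceAs (NatTrans.IsMonoidal F.functor.leftUnitor.hom))

@[simp] theorem tensorObj_functor (F F' : TensorAut k C) :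
    (F ⊗ F').functor = F'.functor ⋙ F.functor := rfl

@[simp] theorem tensorUnit_functor : (𝟙_ (TensorAut k C)).functor = 𝟭 C := rfl

@[simp] theorem whiskerLeft_app (F : TensorAut k C) {F' F'' : TensorAut k C} (α : F' ⟶ F'')
    (V : C) : (Hom.iso (F ◁ α)).hom.app V = F.functor.map ((Hom.iso α).hom.app V) := rfl

@[simp] theorem whiskerRight_app {F F' : TensorAut k C} (α : F ⟶ F') (F'' : TensorAut k C)
    (V : C) : (Hom.iso (α ▷ F'')).hom.app V = (Hom.iso α).hom.app (F''.functor.obj V) := rfl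

@[simp] theorem tensorHom_app {F₁ F₂ F₃ F₄ : TensorAut k C} (α : F₁ ⟶ F₂) (β : F₃ ⟶ F₄)
    (V : C) : (Hom.iso (α ⊗ₘ β)).hom.app V =
      (Hom.iso α).hom.app (F₃.functor.obj V) ≫ F₂.functor.map ((Hom.iso β).hom.app V) := rfl

@[simp] theorem associator_hom_app (F F' F'' : TensorAut k C) (V : C) :
    (Hom.iso (α_ F F' F'').hom).hom.app V =
      𝟙 (F.functor.obj (F'.functor.obj (F''.functor.obj V))) := rfl

@[simp] theorem leftUnitor_hom_app (F : TensorAut k C) (V : C) :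
    (Hom.iso (λ_ F).hom).hom.app V = 𝟙 (F.functor.obj V) := rfl

@[simp] theorem rightUnitor_hom_app (F : TensorAut k C) (V : C) :
    (Hom.iso (ρ_ F).hom).hom.app V = 𝟙 (F.functor.obj V) := rfl

instance : MonoidalCategory (TensorAut k C) where
  tensorHom_def _ _ := rfl
  id_tensorHom_id _ _ := hom_ext fun V => by simp
  tensorHom_comp_tensorHom _ _ _ _ := hom_ext fun V => by simp
  whiskerLeft_id _ _ := hom_ext fun V => by simp
  id_whiskerRight _ _ := hom_ext fun V => by simp
  associator_naturality _ _ _ := hom_ext fun V => by simp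
  leftUnitor_naturality _ := hom_ext fun V => by simp
  rightUnitor_naturality _ := hom_ext fun V => by simp
  pentagon _ _ _ _ := hom_ext fun V => by simp
  triangle _ _ := hom_ext fun V => by simp

@[simp] theorem leftUnitor_inv_app (F : TensorAut k C) (V : C) :
    (Hom.iso (λ_ F).inv).hom.app V = 𝟙 (F.functor.obj V) := rfl

@[simp] theorem rightUnitor_inv_app (F : TensorAut k C) (V : C) :
    (Hom.iso (ρ_ F).inv).hom.app V = 𝟙 (F.functor.obj V) := rfl

/-- The tensor autoequivalences of `C` form a categorical group. -/
instance : CategoricalGroup (TensorAut k C) where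
  isIso_hom α := ⟨{ iso := (Hom.iso α).symm
                    isMonoidal := inferInstanceAs (NatTrans.IsMonoidal (Hom.iso α).inv) },
    Hom.ext (Hom.iso α).self_symm_id, Hom.ext (Hom.iso α).symm_self_id⟩
  exists_inverse F := by
    let E : C ≌ C := F.functor.asEquivalence
    letI : E.functor.Monoidal := F.monoidal
    letI : E.inverse.Monoidal := E.inverseMonoidal
    haveI : E.IsMonoidal :=
      { leftAdjoint_ε := E.toAdjunction.rightAdjointLaxMonoidal_ε
        leftAdjoint_μ := E.toAdjunction.rightAdjointLaxMonoidal_μ }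
    haveI : E.functor.Additive := F.additive
    haveI : E.functor.Linear k := F.linear
    let F' : TensorAut k C := { functor := E.inverse }
    exact ⟨F', ⟨mkIso (F := comp F F') (F' := one k C) E.counitIso
        (h := inferInstanceAs (NatTrans.IsMonoidal E.counit))⟩,
      ⟨(mkIso (F := one k C) (F' := comp F' F) E.unitIso
        (h := inferInstanceAs (NatTrans.IsMonoidal E.unit))).symm⟩⟩

/-- A monoidal automorphism `a` of `id_C` acts on a tensor autoequivalence `F` by `a_{F(V)}`. -/
theorem leftAct_app (a : CategoricalGroup.Pi1 (TensorAut k C)) (F : TensorAut k C) (V : C) :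
    (Hom.iso (CategoricalGroup.leftAct a F)).hom.app V =
      (Hom.iso a.hom).hom.app (F.functor.obj V) := by
  simp [CategoricalGroup.leftAct]

/-- The action of `[F]` on a monoidal automorphism `a` of `id_C` is characterized by
`([F] • a)_{F(V)} = F(a_V)`. -/
theorem smul_app (F : TensorAut k C) (a : CategoricalGroup.Pi1 (TensorAut k C)) (V : C) :
    (Hom.iso (CategoricalGroup.Pi0.mk F • a).hom).hom.app (F.functor.obj V) =
      F.functor.map ((Hom.iso a.hom).hom.app V) := by
  rw [← leftAct_app, CategoricalGroup.leftAct_smul]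
  simp [CategoricalGroup.rightAct]

end TensorAut

/-- The group `Aut_⊗(C)` of isomorphism classes of tensor autoequivalences of `C`. -/
abbrev AutTensor := CategoricalGroup.Pi0 (TensorAut k C)

/-- The group `Aut_⊗(id_C)` of monoidal natural automorphisms of the identity functor of `C`. -/
abbrev AutTensorId := CategoricalGroup.Pi1 (TensorAut k C)

/-- An action of a group `G` on `C`: a monoidal functor from the discrete categorical group of `G`
to the categorical group of tensor autoequivalences of `C`. -/
abbrev GAction (G : Type*) [Group G] := CategoricalGroup.DiscreteMonoidalFunctor G (TensorAut k C)

end Tensor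
end

/-! The argument works in any categorical group; tensor autoequivalences enter only as an instance.
Fix objects `X g` in the classes `f g`. Since `π₁` is identified with the automorphisms of each
object (`leftAct_bijective`), the systems `μ g h : X g ⊗ X h ⟶ X (g * h)` are a torsor under
2-cochains, once one exists (`twist_bijective`). The failure of associativity is a 3-cochain, and
twisting by `z` changes it by the coboundary of `z` (`isAssociative_twist_iff`). For `X g = rep (f
g)` with the chosen isomorphisms, this defect is the pullback of the associator cocycle, so an
associative system exists exactly when its class vanishes.

An associative system is the same as a monoidal structure, because the unit isomorphism exists
(`exists_unit`) and is unique (`RealizationOn.μ_injective`).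

For the classification, take an associative system as base point. Its associative twists are those
by 2-cocycles, a monoidal isomorphism between two of them is a 1-cochain whose coboundary is the
quotient of the two cocycles (`RealizationOn.twist_equiv_iff`), and every realization can be
transported to the objects `X g`. -/

noncomputable section

namespace CategoricalGroup

/-! ### Associative systems and monoidal structures on a family of objects -/

section MonoidalStructures

variable {𝒢 : Type u} [Category.{v} 𝒢] [MonoidalCategory 𝒢]
  {G : Type w} [Group G] {X : G → 𝒢}

/-- The automorphisms `a g h j` of the unit object measure the failure of the morphisms
`μ g h : X g ⊗ X h ⟶ X (g * h)` to be associative. -/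
def HasDefect (μ : ∀ g h, X g ⊗ X h ⟶ X (g * h)) (a : G → G → G → Pi1 𝒢) : Prop :=
  ∀ g h j, μ g h ▷ X j ≫ μ (g * h) j ≫ eqToHom (congrArg X (mul_assoc g h j)) ≫
      leftAct (a g h j) (X (g * (h * j))) =
    (α_ (X g) (X h) (X j)).hom ≫ X g ◁ μ h j ≫ μ g (h * j)

/-- Associativity of a system of morphisms `X g ⊗ X h ⟶ X (g * h)`. -/
def IsAssociative (μ : ∀ g h, X g ⊗ X h ⟶ X (g * h)) : Prop :=
  ∀ g h j, μ g h ▷ X j ≫ μ (g * h) j ≫ eqToHom (congrArg X (mul_assoc g h j)) =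
    (α_ (X g) (X h) (X j)).hom ≫ X g ◁ μ h j ≫ μ g (h * j)

/-- The system of morphisms `μ` followed by the action of `z`. -/
def twist (μ : ∀ g h, X g ⊗ X h ⟶ X (g * h)) (z : G × G → Pi1 𝒢) (g h : G) :
    X g ⊗ X h ⟶ X (g * h) :=
  μ g h ≫ leftAct (z (g, h)) (X (g * h))

theorem IsAssociative.hasDefect {μ : ∀ g h, X g ⊗ X h ⟶ X (g * h)} (hμ : IsAssociative μ) :
    HasDefect μ fun _ _ _ => 1 := fun g h j => by
  rw [leftAct_one, Category.comp_id, hμ]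

theorem RealizationOn.isAssociative (m : RealizationOn X) : IsAssociative m.μ := fun g h j =>
  m.toLaxMonoidal.associativity ⟨g⟩ ⟨h⟩ ⟨j⟩

variable [CategoricalGroup 𝒢]

/-- Tensoring with an inverse object `W` is a quasi-inverse of tensoring with `X`, so the functor is
fully faithful. -/
theorem whiskerRight_bijective (X : 𝒢) {Y Z : 𝒢} :
    Function.Bijective (fun h : Y ⟶ Z => h ▷ X) := by
  obtain ⟨W, ⟨i⟩, ⟨j⟩⟩ := exists_inverse X
  let E : 𝒢 ≌ 𝒢 := CategoryTheory.Equivalence.mk (tensorRight X) (tensorRight W)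
    ((rightUnitorNatIso 𝒢).symm ≪≫ (tensoringRight 𝒢).mapIso i.symm ≪≫ tensorRightTensor X W)
    ((tensorRightTensor W X).symm ≪≫ (tensoringRight 𝒢).mapIso j ≪≫ rightUnitorNatIso 𝒢)
  have hE : (tensorRight X).IsEquivalence := E.isEquivalence_functor
  exact ⟨(tensorRight X).map_injective, (tensorRight X).map_surjective⟩

/-- All `μ g h` are invertible and `π₁` acts simply transitively on the automorphisms of `X (g *
h)`, so any two systems differ by a unique 2-cochain. -/
theorem twist_bijective (μ : ∀ g h, X g ⊗ X h ⟶ X (g * h)) : Function.Bijective (twist μ) := by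
  constructor
  · intro z z' h
    funext ⟨g, k⟩
    have := isIso_hom (μ g k)
    exact (leftAct_bijective (X (g * k))).1 ((cancel_epi (μ g k)).1 (congrFun (congrFun h g) k))
  · intro ν
    have (g h : G) := isIso_hom (μ g h)
    choose z hz using fun g h => (leftAct_bijective (X (g * h))).2 (inv (μ g h) ≫ ν g h)
    refine ⟨fun p => z p.1 p.2, funext fun g => funext fun h => ?_⟩
    have := hz g h
    dsimp only at this
    simp [twist, this]

/-- By naturality every factor from `π₁` can be moved to the end of the composite. Whiskering on the
right leaves it unchanged, while whiskering by `X g` on the left applies `f g`; this is the origin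
of the twisted term in the coboundary. -/
theorem isAssociative_twist_iff {f : G →* Pi0 𝒢} (hX : ∀ g, Pi0.mk (X g) = f g)
    {μ : ∀ g h, X g ⊗ X h ⟶ X (g * h)} {a : G → G → G → Pi1 𝒢} (hμ : HasDefect μ a)
    (z : G × G → Pi1 𝒢) : IsAssociative (twist μ z) ↔
      ∀ g h j, z (g * h, j) * z (g, h) = a g h j * ((f g • z (h, j)) * z (g, h * j)) := by
  refine forall_congr' fun g => forall_congr' fun h => forall_congr' fun j => ?_
  have e₁ : twist μ z g h ▷ X j ≫ twist μ z (g * h) j ≫ eqToHom (congrArg X (mul_assoc g h j)) =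
      (μ g h ▷ X j ≫ μ (g * h) j ≫ eqToHom (congrArg X (mul_assoc g h j))) ≫
        leftAct (z (g * h, j) * z (g, h)) (X (g * (h * j))) := by
    simp only [twist, comp_whiskerRight, Category.assoc, leftAct_whiskerRight, leftAct_mul,
      leftAct_naturality_assoc _ (μ (g * h) j), leftAct_naturality _ (eqToHom _),
      leftAct_naturality_assoc _ (eqToHom _)]
  have e₂ : (α_ (X g) (X h) (X j)).hom ≫ X g ◁ twist μ z h j ≫ twist μ z g (h * j) =
      (μ g h ▷ X j ≫ μ (g * h) j ≫ eqToHom (congrArg X (mul_assoc g h j))) ≫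
        leftAct (a g h j * ((f g • z (h, j)) * z (g, h * j))) (X (g * (h * j))) := by
    rw [mul_comm (a g h j), mul_comm (f g • _)]
    simp only [leftAct_mul, Category.assoc, twist, whiskerLeft_comp, whiskerLeft_leftAct,
      leftAct_naturality_assoc _ (μ g (h * j)), hX]
    have := hμ g h j
    simp only [← Category.assoc] at this ⊢
    rw [this]
  have := isIso_hom (μ g h ▷ X j ≫ μ (g * h) j ≫ eqToHom (congrArg X (mul_assoc g h j)))
  rw [e₁, e₂, cancel_epi, (leftAct_bijective (X (g * (h * j)))).1.eq_iff]

/-- As for an associative product with invertible multiplication maps, a unit comes for free: the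
left unit law at `1` determines `ε`, and associativity spreads it to all `g` on both sides. -/
theorem exists_unit {μ : ∀ g h, X g ⊗ X h ⟶ X (g * h)} (hμ : IsAssociative μ) :
    ∃ ε : 𝟙_ 𝒢 ⟶ X 1,
      (∀ g, ε ▷ X g ≫ μ 1 g ≫ eqToHom (congrArg X (one_mul g)) = (λ_ (X g)).hom) ∧
      (∀ g, X g ◁ ε ≫ μ g 1 ≫ eqToHom (congrArg X (mul_one g)) = (ρ_ (X g)).hom) := by
  have (g h : G) := isIso_hom (μ g h)
  have key {g h i : G} (e : g * h = i) {Y : 𝒢} {p q : Y ⟶ X g ⊗ X h} :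
      p ≫ μ g h ≫ eqToHom (congrArg X e) = q ≫ μ g h ≫ eqToHom (congrArg X e) ↔ p = q :=
    ⟨fun H => by rwa [← cancel_mono (μ g h ≫ eqToHom (congrArg X e))], fun H => by rw [H]⟩
  obtain ⟨ε, hε⟩ := (whiskerRight_bijective (X 1)).2
    ((λ_ (X 1)).hom ≫ inv (μ 1 1 ≫ eqToHom (congrArg X (one_mul 1))))
  have h11 : ε ▷ X 1 ≫ μ 1 1 ≫ eqToHom (congrArg X (one_mul 1)) = (λ_ (X 1)).hom := by
    change ε ▷ X 1 = _ at hε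
    rw [hε, Category.assoc, IsIso.inv_hom_id, Category.comp_id]
  -- The products are free variables here, so that instances such as `1 * g = g` carry no nested
  -- transports.
  have assoc {g h i gh hi ghi : G} (e₁ : g * h = gh) (e₂ : gh * i = ghi) (e₃ : h * i = hi)
      (e₄ : g * hi = ghi) :
      (μ g h ≫ eqToHom (congrArg X e₁)) ▷ X i ≫ μ gh i ≫ eqToHom (congrArg X e₂) =
        (α_ (X g) (X h) (X i)).hom ≫ X g ◁ (μ h i ≫ eqToHom (congrArg X e₃)) ≫
          μ g hi ≫ eqToHom (congrArg X e₄) := by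
    subst e₁ e₃ e₄
    simpa using hμ g h i
  refine ⟨ε, fun g => ?_, fun g => ?_⟩
  -- Associativity at `(1, 1, g)`, precomposed with `ε`: the law at `1` removes one `μ 1 1`, and `𝟙_
  -- 𝒢 ◁ μ 1 g` is then cancelled.
  · have A := assoc (one_mul 1) (one_mul g) (one_mul g) (one_mul g)
    have B := congrArg (fun p => (ε ▷ X 1) ▷ X g ≫ p) A
    rw [← comp_whiskerRight_assoc, h11, associator_naturality_left_assoc,
      ← whisker_exchange_assoc] at B
    have := isIso_hom (μ 1 g ≫ eqToHom (congrArg X (one_mul g)))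
    rw [← cancel_epi (𝟙_ 𝒢 ◁ (μ 1 g ≫ eqToHom (congrArg X (one_mul g)))),
      ← cancel_epi (α_ _ _ _).hom, ← B, leftUnitor_naturality]
    simp
  -- Associativity at `(g, 1, 1)` with `ε` in the middle: by the triangle identity the right unit
  -- law holds after whiskering with `X 1`, which is faithful.
  · have A := assoc (mul_one g) (mul_one g) (one_mul 1) (mul_one g)
    have B := congrArg (fun p => (X g ◁ ε) ▷ X 1 ≫ p) A
    rw [← comp_whiskerRight_assoc, associator_naturality_middle_assoc, ← whiskerLeft_comp_assoc,
      h11, triangle_assoc, key (mul_one g)] at B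
    exact (whiskerRight_bijective (X 1)).1 B

/-- The realization given by an associative system of morphisms. -/
abbrev realizationOnOfIsAssociative (μ : ∀ g h, X g ⊗ X h ⟶ X (g * h)) (hμ : IsAssociative μ) :
    RealizationOn X :=
  have (g h : G) := isIso_hom (μ g h)
  have := isIso_hom (exists_unit hμ).choose
  Functor.CoreMonoidal.toMonoidal
    { εIso := asIso (exists_unit hμ).choose
      μIso := fun g h => asIso (μ g.as h.as)
      μIso_hom_natural_left := by
        rintro ⟨g⟩ ⟨h⟩ ⟨⟨e⟩⟩ ⟨j⟩
        obtain rfl : g = h := e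
        change (𝟙 (X g)) ▷ X j ≫ μ g j = μ g j ≫ 𝟙 _
        simp
      μIso_hom_natural_right := by
        rintro ⟨g⟩ ⟨h⟩ ⟨j⟩ ⟨⟨e⟩⟩
        obtain rfl : g = h := e
        change X j ◁ (𝟙 (X g)) ≫ μ j g = μ j g ≫ 𝟙 _
        simp
      associativity := fun g h j => hμ g.as h.as j.as
      left_unitality := fun g => ((exists_unit hμ).choose_spec.1 g.as).symm
      right_unitality := fun g => ((exists_unit hμ).choose_spec.2 g.as).symm }

/-- The condition on the units is a consequence of the condition on the tensorators. -/
theorem isMonoidal_of_tensor {R S : Discrete G ⥤ 𝒢} [R.Monoidal] [S.Monoidal] (τ : R ⟶ S)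
    (h : ∀ g h : Discrete G, Functor.LaxMonoidal.μ R g h ≫ τ.app (g ⊗ h) =
      (τ.app g ⊗ₘ τ.app h) ≫ Functor.LaxMonoidal.μ S g h) : NatTrans.IsMonoidal τ where
  unit := by
    -- After whiskering, left unitality of `R` and `S` eliminates the unit morphism of `S`; what
    -- remains follows from `h` at the pair of unit objects.
    apply (whiskerRight_bijective (S.obj (𝟙_ _))).1
    have := isIso_hom (R.obj (𝟙_ (Discrete G)) ◁ τ.app (𝟙_ _))
    have h1 := h (𝟙_ _) (𝟙_ _)
    dsimp only
    have h0 := isIso_hom (τ.app (𝟙_ _))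
    rw [← cancel_mono (Functor.LaxMonoidal.μ S (𝟙_ _) (𝟙_ _) ≫ S.map (λ_ (𝟙_ _)).hom),
      ← Functor.LaxMonoidal.left_unitality, ← cancel_epi (𝟙_ 𝒢 ◁ τ.app (𝟙_ _)),
      leftUnitor_naturality, Functor.LaxMonoidal.left_unitality R]
    rw [tensorHom_def'] at h1
    simp only [comp_whiskerRight, Category.assoc] at h1 ⊢
    rw [whisker_exchange_assoc, ← reassoc_of% h1, τ.naturality]
  tensor := h

/-- Two monoidal structures on `X` with the same tensorators are equal. -/
theorem RealizationOn.μ_injective : Function.Injective (RealizationOn.μ (X := X)) := by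
  intro m m' h
  apply Functor.Monoidal.toLaxMonoidal_injective
  apply Functor.LaxMonoidal.ext
  -- The identity transformation from `m` to `m'` respects the tensorators, hence the units, which
  -- says that the unit morphisms agree.
  · have := (@isMonoidal_of_tensor _ _ _ _ _ _ (Discrete.functor X) (Discrete.functor X) m m' (𝟙 _)
      (fun g k => by
        rw [show @Functor.LaxMonoidal.μ _ _ _ _ _ _ _ m.toLaxMonoidal g k =
          @Functor.LaxMonoidal.μ _ _ _ _ _ _ _ m'.toLaxMonoidal g k from
            congrFun (congrFun h g.as) k.as]
        simp)).unit
    simpa using this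
  · exact funext fun g => funext fun k => congrFun (congrFun h g.as) k.as

end MonoidalStructures

/-! ### Equivalence of realizations and existence -/

section Equivalence

variable {𝒢 : Type u} [Category.{v} 𝒢] [MonoidalCategory 𝒢] [CategoricalGroup 𝒢]
  {G : Type w} [Group G] {X : G → 𝒢} {f : G →* Pi0 𝒢}

theorem leftAct_tensorHom_leftAct (hX : ∀ g, Pi0.mk (X g) = f g) (a b : Pi1 𝒢) (g h : G) :
    (leftAct a (X g) ⊗ₘ leftAct b (X h)) = leftAct (a * f g • b) (X g ⊗ X h) := by
  rw [MonoidalCategory.tensorHom_def, leftAct_whiskerRight, whiskerLeft_leftAct, hX, mul_comm, leftAct_mul]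

/-- On a discrete source a natural automorphism is an arbitrary family of automorphisms of the `X
g`, that is, a 1-cochain `c`. Only the tensorator condition has to be imposed, by
`isMonoidal_of_tensor`. -/
theorem RealizationOn.toRealization_equiv_iff (hX : ∀ g, Pi0.mk (X g) = f g)
    (m m' : RealizationOn X) : m.toRealization hX ≈ m'.toRealization hX ↔
      ∃ c : G → Pi1 𝒢, ∀ g h, m.μ g h ≫ leftAct (c (g * h)) (X (g * h)) =
        m'.μ g h ≫ leftAct (c g * f g • c h) (X (g * h)) := by
  constructor
  · rintro ⟨e, he⟩
    choose c hc using fun g => (leftAct_bijective (X g)).2 (e.hom.app ⟨g⟩)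
    have hc' : ∀ g, leftAct (c g) (X g) = e.hom.app ⟨g⟩ := hc
    refine ⟨c, fun g h => ?_⟩
    rw [← leftAct_naturality _ (m'.μ g h), ← leftAct_tensorHom_leftAct hX, hc', hc', hc']
    exact he.tensor ⟨g⟩ ⟨h⟩
  · rintro ⟨c, hc⟩
    have (g : G) := isIso_hom (leftAct (c g) (X g))
    refine ⟨Discrete.natIso (F := Discrete.functor X) (G := Discrete.functor X)
      fun g => asIso (leftAct (c g.as) (X g.as)), ?_⟩
    refine @isMonoidal_of_tensor _ _ _ _ _ _ (Discrete.functor X) (Discrete.functor X) m m' _ ?_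
    intro g h
    change m.μ g.as h.as ≫ leftAct (c (g.as * h.as)) (X (g.as * h.as)) =
      (leftAct (c g.as) (X g.as) ⊗ₘ leftAct (c h.as) (X h.as)) ≫ m'.μ g.as h.as
    rw [hc, leftAct_tensorHom_leftAct hX, leftAct_naturality]

/-- The monoidal structure of `R` is transported along arbitrary isomorphisms from its objects to
the `X g`; naturality is automatic over a discrete category. -/
theorem Realization.exists_equiv_toRealization (R : Realization f)
    (hX : ∀ g, Pi0.mk (X g) = f g) : ∃ m : RealizationOn X, m.toRealization hX ≈ R := by
  have e (g : G) : Nonempty (R.1.functor.obj ⟨g⟩ ≅ X g) := by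
    rw [← Pi0.mk_eq_iff, hX]
    exact DFunLike.congr_fun R.2 g
  let i : R.1.functor ≅ Discrete.functor X := Discrete.natIso fun g => (e g.as).some
  refine ⟨Functor.Monoidal.transport i, Setoid.symm ⟨i, ?_⟩⟩
  exact Functor.Monoidal.natTransIsMonoidal_of_transport i

theorem exists_pi0_eq_iff (hX : ∀ g, Pi0.mk (X g) = f g) :
    (∃ R : DiscreteMonoidalFunctor G 𝒢, R.pi0 = f) ↔ Nonempty (RealizationOn X) :=
  ⟨fun ⟨R, hR⟩ => (Realization.exists_equiv_toRealization ⟨R, hR⟩ hX).nonempty,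
    fun ⟨m⟩ => ⟨(m.toRealization hX).1, (m.toRealization hX).2⟩⟩

/-- A system of isomorphisms with defect `a` can be corrected to an associative one if and only if
`a` is a coboundary. -/
theorem nonempty_realizationOn_iff (hX : ∀ g, Pi0.mk (X g) = f g)
    {μ : ∀ g h, X g ⊗ X h ⟶ X (g * h)} {a : G → G → G → Pi1 𝒢} (hμ : HasDefect μ a) :
    Nonempty (RealizationOn X) ↔ ∃ z : G × G → Pi1 𝒢,
      ∀ g h j, z (g * h, j) * z (g, h) = a g h j * ((f g • z (h, j)) * z (g, h * j)) := by
  simp_rw [← isAssociative_twist_iff hX hμ]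
  constructor
  · rintro ⟨m⟩
    obtain ⟨z, hz⟩ := (twist_bijective μ).2 m.μ
    exact ⟨z, hz ▸ m.isAssociative⟩
  · rintro ⟨z, hz⟩
    exact ⟨realizationOnOfIsAssociative _ hz⟩

theorem Choices.hasDefect (D : Choices 𝒢) (f : G →* Pi0 𝒢) :
    HasDefect (X := fun g => D.rep (f g)) (fun g h => (D.φ' (map_mul f g h).symm).hom)
      fun g h j => D.assoc (f g) (f h) (f j) := fun g h j => by
  rw [← D.assoc_spec (map_mul f g h).symm (u := f (g * h)) (w := f (g * (h * j))) (v := f (h * j))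
    (by rw [← map_mul, mul_assoc]) (map_mul f h j).symm (map_mul f g (h * j)).symm]
  simp [φ']

end Equivalence

end CategoricalGroup

/-! ### Vanishing of cohomology classes in terms of explicit cochains -/

namespace groupCohomology

variable {k G : Type u} [CommRing k] [Group G] (A : Rep.{u} k G)

/-- Cohomology is the cokernel of the map from cochains to cocycles, so a class vanishes when the
cocycle is in its image; this can be tested on cochains since `iCocycles` is injective. -/
theorem π_succ_eq_zero_iff (n : ℕ) (x : cocycles A (n + 1)) :
    π A (n + 1) x = 0 ↔
      ∃ y : (Fin n → G) → A, inhomogeneousCochains.d A n y = iCocycles A (n + 1) x := by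
  have hS := ShortComplex.exact_of_g_is_cokernel (ShortComplex.mk _ _
    ((inhomogeneousCochains A).toCycles_comp_homologyπ n (n + 1)))
    ((inhomogeneousCochains A).homologyIsCokernel n (n + 1) (by simp))
  have hi : Function.Injective (iCocycles A (n + 1)) :=
    (ModuleCat.mono_iff_injective _).1 inferInstance
  rw [ShortComplex.moduleCat_exact_iff] at hS
  have hd (y : (Fin n → G) → A) : iCocycles A (n + 1) (toCocycles A n (n + 1) y) =
      inhomogeneousCochains.d A n y := by
    rw [← inhomogeneousCochains.d_def]
    exact congr($((inhomogeneousCochains A).toCycles_i n (n + 1)) y)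
  constructor
  · intro h
    obtain ⟨y, hy⟩ := hS x h
    refine ⟨y, ?_⟩
    rw [← hd]
    exact congrArg _ hy
  · rintro ⟨y, hy⟩
    rw [← hd] at hy
    rw [← hi hy]
    exact congr($((inhomogeneousCochains A).toCycles_comp_homologyπ n (n + 1)) y)

theorem exists_d_two_eq_iff (x : (Fin 3 → G) → A) :
    (∃ y : (Fin 2 → G) → A, inhomogeneousCochains.d A 2 y = x) ↔ ∃ z : G × G → A, ∀ g h j,
      A.ρ g (z (h, j)) - z (g * h, j) + z (g, h * j) - z (g, h) = x ![g, h, j] := by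
  have key (y : (Fin 2 → G) → A) (g h j : G) : inhomogeneousCochains.d A 2 y ![g, h, j] =
      A.ρ g (y ![h, j]) - y ![g * h, j] + y ![g, h * j] - y ![g, h] := by
    rw [inhomogeneousCochains.d_hom_apply, Fin.sum_univ_three,
      show (fun i : Fin 2 => ![g, h, j] i.succ) = ![h, j] from rfl,
      show Fin.contractNth 0 (· * ·) ![g, h, j] = ![g * h, j] by ext i; fin_cases i <;> rfl,
      show Fin.contractNth 1 (· * ·) ![g, h, j] = ![g, h * j] by ext i; fin_cases i <;> rfl,
      show Fin.contractNth 2 (· * ·) ![g, h, j] = ![g, h] by ext i; fin_cases i <;> rfl]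
    simp [pow_succ]
    abel
  constructor
  · rintro ⟨y, rfl⟩
    exact ⟨fun p => y ![p.1, p.2], fun g h j => (key y g h j).symm⟩
  · rintro ⟨z, hz⟩
    refine ⟨fun t => z (t 0, t 1), funext fun t => ?_⟩
    have ht : t = ![t 0, t 1, t 2] := by ext i; fin_cases i <;> rfl
    rw [ht, key]
    exact hz _ _ _

end groupCohomology

/-! ### Obstruction class and classification by cocycles -/

namespace CategoricalGroup

variable {𝒢 : Type u} [Category.{u} 𝒢] [MonoidalCategory 𝒢] [CategoricalGroup 𝒢]
  {G : Type u} [Group G] (f : G →* Pi0 𝒢)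

/-- Puts the vanishing of the class in the form of the correction equation of
`nonempty_realizationOn_iff`. -/
theorem Choices.pullbackH3_assocClass_eq_zero_iff (D : Choices 𝒢) :
    pullbackH3 f D.assocClass = 0 ↔ ∃ z : G × G → Pi1 𝒢, ∀ g h j,
      z (g * h, j) * z (g, h) =
        D.assoc (f g) (f h) (f j) * ((f g • z (h, j)) * z (g, h * j)) := by
  have h₁ : pullbackH3 f D.assocClass = groupCohomology.π (pi1Res f) 3
      (groupCohomology.cocyclesMap f (𝟙 (pi1Res f)) 3
        (groupCohomology.cocyclesMk D.assocCochain D.d_assocCochain)) :=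
    groupCohomology.π_map_apply f (𝟙 (pi1Res f)) 3 _
  have h₂ : groupCohomology.iCocycles (pi1Res f) 3
      (groupCohomology.cocyclesMap f (𝟙 (pi1Res f)) 3
        (groupCohomology.cocyclesMk D.assocCochain D.d_assocCochain)) =
      fun g : Fin 3 → G => D.assocCochain fun i => f (g i) := by
    have := congr($(HomologicalComplex.cyclesMap_i (groupCohomology.cochainsMap f (𝟙 (pi1Res f))) 3)
      (groupCohomology.cocyclesMk D.assocCochain D.d_assocCochain))
    refine this.trans ?_
    rw [ModuleCat.comp_apply, groupCohomology.iCocycles_mk]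
    rfl
  rw [h₁, groupCohomology.π_succ_eq_zero_iff, h₂, groupCohomology.exists_d_two_eq_iff]
  have key (a b c d e : Pi1 𝒢) : a / b * c / d = e ↔ b⁻¹ * d⁻¹ = e * (a⁻¹ * c⁻¹) := by
    rw [div_eq_iff_eq_mul, div_mul_eq_mul_div, div_eq_iff_eq_mul, ← mul_inv, ← mul_inv,
      eq_mul_inv_iff_mul_eq, inv_mul_eq_iff_eq_mul, mul_comm e, mul_comm b, mul_right_comm]
  -- The correcting cochain is the inverse of the one whose coboundary is the associator cocycle.
  refine (Equiv.inv (G × G → Pi1 𝒢)).exists_congr fun z => forall_congr' fun g =>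
    forall_congr' fun h => forall_congr' fun j => ?_
  change (f g • z (h, j)) / z (g * h, j) * z (g, h * j) / z (g, h) =
    D.assoc (f g) (f h) (f j) ↔ (z (g * h, j))⁻¹ * (z (g, h))⁻¹ =
      D.assoc (f g) (f h) (f j) * ((f g • (z (h, j))⁻¹) * (z (g, h * j))⁻¹)
  rw [key, smul_inv']

/-- The base point `m₀` has trivial defect, so the equation for an associative twist reduces to the
2-cocycle identity. -/
theorem RealizationOn.exists_equiv_cocycles₂ {f : G →* Pi0 𝒢} {X : G → 𝒢}
    (hX : ∀ g, Pi0.mk (X g) = f g) (m₀ : RealizationOn X) :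
    ∃ e : groupCohomology.cocycles₂ (pi1Res f) ≃ RealizationOn X,
      ∀ z, (e z).μ = twist m₀.μ fun p => Additive.toMul (z p) := by
  have hz (z : G × G → Pi1 𝒢) : IsAssociative (twist m₀.μ z) ↔
      (fun p => Additive.ofMul (z p) : G × G → Additive (Pi1 𝒢)) ∈
        groupCohomology.cocycles₂ (pi1Res f) := by
    rw [isAssociative_twist_iff hX m₀.isAssociative.hasDefect, groupCohomology.mem_cocycles₂_iff]
    simp only [one_mul]
    rfl
  refine ⟨Equiv.ofBijective (fun z => realizationOnOfIsAssociative
    (twist m₀.μ fun p => Additive.toMul (z p)) ((hz _).2 z.2)) ⟨fun z z' h => ?_, fun m => ?_⟩,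
    fun z => rfl⟩
  · have := (twist_bijective m₀.μ).1 (congrArg RealizationOn.μ h)
    exact groupCohomology.cocycles₂_ext fun g h => congrFun this (g, h)
  · obtain ⟨z, h⟩ := (twist_bijective m₀.μ).2 m.μ
    exact ⟨⟨_, (hz z).1 (h ▸ m.isAssociative)⟩, RealizationOn.μ_injective h⟩

/-- Cancelling `m₀.μ` from the equivalence condition leaves an identity in `π₁` saying that the
coboundary of `c` is `z / z'`. -/
theorem RealizationOn.twist_equiv_iff {f : G →* Pi0 𝒢} {X : G → 𝒢}
    (hX : ∀ g, Pi0.mk (X g) = f g) {m₀ m m' : RealizationOn X}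
    (z z' : groupCohomology.cocycles₂ (pi1Res f))
    (hm : m.μ = twist m₀.μ fun p => Additive.toMul (z p))
    (hm' : m'.μ = twist m₀.μ fun p => Additive.toMul (z' p)) :
    m.toRealization hX ≈ m'.toRealization hX ↔
      groupCohomology.H2π (pi1Res f) z = groupCohomology.H2π (pi1Res f) z' := by
  rw [toRealization_equiv_iff, groupCohomology.H2π_eq_iff, hm, hm']
  have (g h : G) := isIso_hom (m₀.μ g h)
  refine exists_congr fun c => ?_
  rw [funext_iff, Prod.forall]
  refine forall_congr' fun g => forall_congr' fun h => ?_
  simp only [twist, Category.assoc, cancel_epi, ← leftAct_mul,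
    (leftAct_bijective (X (g * h))).1.eq_iff]
  have key (a b c d e : Pi1 𝒢) : c * d = b * a * e ↔ a / c * b = d / e := by
    rw [eq_div_iff_mul_eq', div_mul_eq_mul_div, div_mul_eq_mul_div, div_eq_iff_eq_mul,
      mul_comm c, mul_comm b, eq_comm]
  exact key (f g • c h) (c g) (c (g * h)) (z (g, h)) (z' (g, h))

end CategoricalGroup

theorem CategoricalGroup.exists_equiv_H2 {𝒢 : Type u} [Category.{u} 𝒢] [MonoidalCategory 𝒢]
    [CategoricalGroup 𝒢] {G : Type u} [Group G] {f : G →* Pi0 𝒢} {X : G → 𝒢}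
    (hX : ∀ g, Pi0.mk (X g) = f g) (m₀ : RealizationOn X) :
    ∃ (e : groupCohomology.cocycles₂ (pi1Res f) ≃ RealizationOn X)
      (e' : groupCohomology.H2 (pi1Res f) ≃ Quotient (realizationSetoid f)),
      (∀ z, e' (groupCohomology.H2π (pi1Res f) z) =
        Quotient.mk (realizationSetoid f) ((e z).toRealization hX)) ∧
      (∀ z g h, (e z).μ g h =
        (e 0).μ g h ≫ leftAct (Additive.toMul (z (g, h))) (X (g * h))) := by
  obtain ⟨e, he⟩ := RealizationOn.exists_equiv_cocycles₂ hX m₀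
  have hiff z z' := RealizationOn.twist_equiv_iff hX z z' (he z) (he z')
  have hsurj : Function.Surjective (groupCohomology.H2π (pi1Res f)) :=
    (ModuleCat.epi_iff_surjective _).1 inferInstance
  -- The map on `H²` is defined through a set-theoretic section `s`; `hmk` shows that the choice of
  -- cocycle does not matter.
  choose s hs using hsurj
  have hmk z : Quotient.mk (realizationSetoid f)
      ((e (s (groupCohomology.H2π (pi1Res f) z))).toRealization hX) =
      Quotient.mk (realizationSetoid f) ((e z).toRealization hX) :=
    Quotient.sound ((hiff _ _).2 (hs _))
  refine ⟨e, Equiv.ofBijective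
    (fun x => Quotient.mk (realizationSetoid f) ((e (s x)).toRealization hX))
    ⟨fun x y h => ?_, fun q => ?_⟩, hmk, fun z g h => ?_⟩
  · have := (hiff _ _).1 (Quotient.exact h)
    rwa [hs, hs] at this
  · obtain ⟨R, rfl⟩ := Quotient.exists_rep q
    obtain ⟨m, hm⟩ := R.exists_equiv_toRealization hX
    refine ⟨groupCohomology.H2π (pi1Res f) (e.symm m), (hmk _).trans ?_⟩
    rw [e.apply_symm_apply]
    exact Quotient.sound hm
  -- The zero cocycle acts trivially, so `e 0` has the tensorators of the base point.
  · have h0 : (e 0).μ = m₀.μ := by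
      rw [he]
      funext g h
      exact (congrArg (m₀.μ g h ≫ ·) (leftAct_one _)).trans (Category.comp_id _)
    rw [h0, he]
    rfl

end
theorem mainTheorem4 {k : Type w} [Field k] {C : Type u} [Category.{v} C] [Abelian C] [Linear k C]
    [MonoidalCategory C] [MonoidalPreadditive C] [TensorCategory k C]
    {G : Type (max u v)} [Group G] (f : G →* AutTensor k C) :
    (∀ D : CategoricalGroup.Choices (TensorAut k C),
      (∃ R : GAction k C G, R.pi0 = f) ↔
        CategoricalGroup.pullbackH3 f D.assocClass = 0) ∧
    ((∃ R : GAction k C G, R.pi0 = f) →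
      ∀ (X : G → TensorAut k C) (hX : ∀ g, CategoricalGroup.Pi0.mk (X g) = f g),
        ∃ (e : groupCohomology.cocycles₂ (CategoricalGroup.pi1Res f) ≃
              CategoricalGroup.RealizationOn X)
          (e' : groupCohomology.H2 (CategoricalGroup.pi1Res f) ≃
              Quotient (CategoricalGroup.realizationSetoid f)),
          (∀ z, e' (groupCohomology.H2π (CategoricalGroup.pi1Res f) z) =
            Quotient.mk (CategoricalGroup.realizationSetoid f) ((e z).toRealization hX)) ∧
          (∀ z g h, (e z).μ g h =
            (e 0).μ g h ≫ CategoricalGroup.leftAct (Additive.toMul (z (g, h))) (X (g * h)))) := by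
  refine ⟨fun D => ?_, fun hR X hX => ?_⟩
  -- Realizability does not depend on the representatives, so those supplied by `D` may be used.
  · rw [D.pullbackH3_assocClass_eq_zero_iff,
      CategoricalGroup.exists_pi0_eq_iff (X := fun g => D.rep (f g)) fun g => D.mk_rep (f g),
      CategoricalGroup.nonempty_realizationOn_iff (fun g => D.mk_rep (f g)) (D.hasDefect f)]
  · obtain ⟨m₀⟩ := (CategoricalGroup.exists_pi0_eq_iff hX).1 hR
    exact CategoricalGroup.exists_equiv_H2 hX m₀
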